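/- For a finite simple graph $G=(V,E)$ and $B\subseteq V$ let $\gamma(B)$ be the minimum cardinality of a set $A\subseteq V$ with $B\subseteq\bigcup_{x\in A}N[x]$, where $N[x]$ is the closed neighbourhood of $x$, and let $$\gamma^i(G)=\max\{\gamma(A) : A \text{ is an independent set of } G\}.$$ A graph is a permutation graph if it is the intersection graph of a family of line segments, each of which connects a point on one of two horizontal lines in the plane with a point on the other. **Theorem.** There exists a polynomial-time algorithm that computes $\gamma^i(G)$ for permutation graphs $G$. That is, there are a single program for a deterministic random access machine (registers and arrays of natural numbers, indirect addressing, addition and truncated subtraction, branching and loops, every elementary instruction and every test being one step) and a polynomial $p$ such that, for every $n\ge 0$ and every permutation graph $G$ with vertex set $\{0,\dots,n-1\}$, given by its adjacency matrix only, the program halts after at most $p(n)$ steps with output $\gamma^i(G)$. -/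

import Mathlib

namespace IndepDom

section Graphs

variable {V : Type*} (G : SimpleGraph V)

/-- `A` dominates `B`: the set `B` is contained in the union of the closed
neighbourhoods `N[x]`, `x ∈ A`. -/
def Dominates (A B : Finset V) : Prop :=
  ∀ b ∈ B, ∃ a ∈ A, b = a ∨ G.Adj a b

/-- `γ_G(B)`, the minimum cardinality of a set of vertices that dominates `B`.
The set of cardinalities is never empty, since `B` dominates itself. -/
noncomputable def domNumber (B : Finset V) : ℕ :=
  sInf {k | ∃ A : Finset V, Dominates G A B ∧ A.card = k}

/-- The independence-domination number `γ^i(G)`, the maximum of `γ(A)` over all independent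
sets `A`. In a finite graph the set of values is bounded by the number of vertices, and it
contains `γ(∅) = 0`, so the supremum is a maximum. -/
noncomputable def indepDomNumber : ℕ :=
  sSup {k | ∃ A : Finset V, G.IsIndepSet (A : Set V) ∧ domNumber G A = k}

/-- The line segment that connects the point with abscissa `t` on the top line `y = 1` with the
point with abscissa `b` on the bottom line `y = 0`. -/
def diagramSegment (t b : ℝ) : Set (ℝ × ℝ) :=
  segment ℝ (t, 1) (b, 0)

/-- `G` is a permutation graph: it is the intersection graph of the line segments of a
permutation diagram, in which `v` is represented by the segment from `top v` to `bot v`. -/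
def IsPermutationGraph : Prop :=
  ∃ top bot : V → ℝ, ∀ u v : V, G.Adj u v ↔
    u ≠ v ∧ (diagramSegment (top u) (bot u) ∩ diagramSegment (top v) (bot v)).Nonempty

end Graphs

/-- Structured programs of a random access machine with registers `0, 1, 2, …` and arrays
`0, 1, 2, …` that all hold natural numbers. Registers and arrays are named by constants of the
program; an array cell is addressed through the content of a register. The arithmetic is
addition and truncated subtraction only. -/
inductive Prog : Type
  | skip : Prog
  /-- `r_d := c` for a constant `c` of the program -/
  | const (d c : ℕ) : Prog
  /-- `r_d := r_a + r_b` -/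
  | add (d a b : ℕ) : Prog
  /-- `r_d := r_a - r_b`, or `0` when `r_a < r_b` -/
  | sub (d a b : ℕ) : Prog
  /-- `r_d := M_m[r_i]` -/
  | load (d m i : ℕ) : Prog
  /-- `M_m[r_i] := r_a` -/
  | store (m i a : ℕ) : Prog
  /-- first `P`, then `Q` -/
  | seq (P Q : Prog) : Prog
  /-- `if r_x ≠ 0 then P else Q` -/
  | ite (x : ℕ) (P Q : Prog) : Prog
  /-- `while r_x ≠ 0 do P` -/
  | loop (x : ℕ) (P : Prog) : Prog

/-- A memory state: the contents of the registers and of the cells of the arrays. -/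
structure State where
  reg : ℕ → ℕ
  arr : ℕ → ℕ → ℕ

namespace State

/-- The state after writing `v` into register `d`. -/
def setReg (s : State) (d v : ℕ) : State :=
  { s with reg := Function.update s.reg d v }

/-- The state after writing `v` into cell `i` of array `m`. -/
def setArr (s : State) (m i v : ℕ) : State :=
  { s with arr := Function.update s.arr m (Function.update (s.arr m) i v) }

end State

/-- `Exec P s s' t`: started in the state `s`, the program `P` halts in the state `s'` after
exactly `t` steps. Each elementary instruction and each test of a register is one step. -/
inductive Exec : Prog → State → State → ℕ → Prop
  | skip (s : State) : Exec .skip s s 1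
  | const (s : State) (d c : ℕ) : Exec (.const d c) s (s.setReg d c) 1
  | add (s : State) (d a b : ℕ) : Exec (.add d a b) s (s.setReg d (s.reg a + s.reg b)) 1
  | sub (s : State) (d a b : ℕ) : Exec (.sub d a b) s (s.setReg d (s.reg a - s.reg b)) 1
  | load (s : State) (d m i : ℕ) : Exec (.load d m i) s (s.setReg d (s.arr m (s.reg i))) 1
  | store (s : State) (m i a : ℕ) :
      Exec (.store m i a) s (s.setArr m (s.reg i) (s.reg a)) 1
  | seq {P Q : Prog} {s s' s'' : State} {t t' : ℕ} :
      Exec P s s' t → Exec Q s' s'' t' → Exec (.seq P Q) s s'' (t + t')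
  | ite_true {x : ℕ} {P Q : Prog} {s s' : State} {t : ℕ} :
      s.reg x ≠ 0 → Exec P s s' t → Exec (.ite x P Q) s s' (t + 1)
  | ite_false {x : ℕ} {P Q : Prog} {s s' : State} {t : ℕ} :
      s.reg x = 0 → Exec Q s s' t → Exec (.ite x P Q) s s' (t + 1)
  | loop_done {x : ℕ} {P : Prog} {s : State} :
      s.reg x = 0 → Exec (.loop x P) s s 1
  | loop_step {x : ℕ} {P : Prog} {s s' s'' : State} {t t' : ℕ} :
      s.reg x ≠ 0 → Exec P s s' t → Exec (.loop x P) s' s'' t' →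
        Exec (.loop x P) s s'' (t + 1 + t')

/-- The machine is deterministic: the initial state determines the final state and the
number of steps. -/
theorem Exec.deterministic {P : Prog} {s s₁ : State} {t₁ : ℕ} (h₁ : Exec P s s₁ t₁) :
    ∀ {s₂ : State} {t₂ : ℕ}, Exec P s s₂ t₂ → s₁ = s₂ ∧ t₁ = t₂ := by
  induction h₁ with
  | seq _ _ ihP ihQ =>
    intro s₂ t₂ h
    cases h with
    | seq hP hQ =>
      obtain ⟨rfl, rfl⟩ := ihP hP
      obtain ⟨rfl, rfl⟩ := ihQ hQ
      exact ⟨rfl, rfl⟩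
  | ite_true hx _ ih =>
    intro s₂ t₂ h
    cases h with
    | ite_true _ hP =>
      obtain ⟨rfl, rfl⟩ := ih hP
      exact ⟨rfl, rfl⟩
    | ite_false hx' _ => exact absurd hx' hx
  | ite_false hx _ ih =>
    intro s₂ t₂ h
    cases h with
    | ite_true hx' _ => exact absurd hx hx'
    | ite_false _ hQ =>
      obtain ⟨rfl, rfl⟩ := ih hQ
      exact ⟨rfl, rfl⟩
  | loop_done hx =>
    intro s₂ t₂ h
    cases h with
    | loop_done _ => exact ⟨rfl, rfl⟩
    | loop_step hx' _ _ => exact absurd hx hx'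
  | loop_step hx _ _ ihP ihL =>
    intro s₂ t₂ h
    cases h with
    | loop_done hx' => exact absurd hx' hx
    | loop_step _ hP hL =>
      obtain ⟨rfl, rfl⟩ := ihP hP
      obtain ⟨rfl, rfl⟩ := ihL hL
      exact ⟨rfl, rfl⟩
  | _ =>
    intro s₂ t₂ h
    cases h
    exact ⟨rfl, rfl⟩

open Classical in
/-- The initial state for a graph on the vertices `0, …, n - 1`: register `0` holds `n`, array
`0` holds the adjacency matrix row by row, and everything else is `0`. -/
noncomputable def inputState {n : ℕ} (G : SimpleGraph (Fin n)) : State where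
  reg r := if r = 0 then n else 0
  arr m k := if m = 0 ∧ ∃ i j : Fin n, G.Adj i j ∧ k = i * n + j then 1 else 0

/-- On every graph of the class `C` with `n` vertices, given by its adjacency matrix, the program
`P` halts after at most `T n` steps with the value `f G` in register `0`. -/
def ComputesWithin (P : Prog) (C : ∀ n, SimpleGraph (Fin n) → Prop)
    (f : ∀ n, SimpleGraph (Fin n) → ℕ) (T : ℕ → ℕ) : Prop :=
  ∀ (n : ℕ) (G : SimpleGraph (Fin n)), C n G →
    ∃ (s : State) (t : ℕ), Exec P (inputState G) s t ∧ t ≤ T n ∧ s.reg 0 = f n G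

end IndepDom

/-! The two coordinates of the segments turn a permutation graph into the incomparability graph of a
strict partial order (`IsPermutationGraph.exists_isIncompGraph`). Independent sets are then chains
of the order, and closed neighbourhoods are convex.

Convexity yields a greedy min-max argument (`exists_packing_dominates`): each independent set
contains a packing, that is, vertices with pairwise distance at least 3, and is dominated by no more
vertices than that packing has. Hence the number sought is the maximum size of a packing.

The program sees only the adjacency matrix, so the order has to be replaced by distances. If `b`
lies between `a` and `c`, then `d(a,b) + d(b,c) ≤ d(a,c) + 2` (`dist_between`). Conversely, for far
apart vertices this inequality, tested against the first vertex of a sequence, forces every step to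
go in the direction of the first one (`exists_packing_of_chain`). So packings in a component
correspond to chains of `Step`s, which a dynamic program over triples (number of steps, start, end)
detects; `indepDomNumber_eq` adds up the components.

The algorithm is written as expressions with sums over numbers below `n`. `runs_compile` and
`runs_fill` translate these into programs with polynomial time bounds. -/

namespace IndepDom

/-! ### Correctness rules with time bounds -/

/-- From `s`, the program `P` halts within `T` steps in a state that satisfies `Q`. -/
def Runs (P : Prog) (s : State) (T : ℕ) (Q : State → Prop) : Prop :=
  ∃ s' t, Exec P s s' t ∧ t ≤ T ∧ Q s'

namespace Runs

variable {P P' : Prog} {s : State} {T T' : ℕ} {Q Q' : State → Prop}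

theorem mono (h : Runs P s T Q) (hT : T ≤ T') (hQ : ∀ s', Q s' → Q' s') : Runs P s T' Q' := by
  obtain ⟨s', t, he, ht, hq⟩ := h
  exact ⟨s', t, he, ht.trans hT, hQ _ hq⟩

theorem seq (h : Runs P s T Q) (h' : ∀ s', Q s' → Runs P' s' T' Q') :
    Runs (.seq P P') s (T + T') Q' := by
  obtain ⟨s', t, he, ht, hq⟩ := h
  obtain ⟨s'', t', he', ht', hq'⟩ := h' s' hq
  exact ⟨s'', t + t', .seq he he', by omega, hq'⟩

theorem const {d c : ℕ} (h : Q (s.setReg d c)) : Runs (.const d c) s 1 Q :=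
  ⟨_, _, .const s d c, le_rfl, h⟩

theorem add {d a b : ℕ} (h : Q (s.setReg d (s.reg a + s.reg b))) : Runs (.add d a b) s 1 Q :=
  ⟨_, _, .add s d a b, le_rfl, h⟩

theorem sub {d a b : ℕ} (h : Q (s.setReg d (s.reg a - s.reg b))) : Runs (.sub d a b) s 1 Q :=
  ⟨_, _, .sub s d a b, le_rfl, h⟩

theorem load {d m i : ℕ} (h : Q (s.setReg d (s.arr m (s.reg i)))) : Runs (.load d m i) s 1 Q :=
  ⟨_, _, .load s d m i, le_rfl, h⟩

theorem store {m i a : ℕ} (h : Q (s.setArr m (s.reg i) (s.reg a))) : Runs (.store m i a) s 1 Q :=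
  ⟨_, _, .store s m i a, le_rfl, h⟩

end Runs

namespace Prog

/-- `r_d := r_a`, for `d ≠ a`. -/
def copy (d a : ℕ) : Prog := .seq (.const d 0) (.add d d a)

/-- Runs `P` with `r_i = r_0 - 1, …, 0`; the register `z` is scratch. -/
def down (i z : ℕ) (P : Prog) : Prog :=
  .seq (copy i 0) (.loop i (.seq (.const z 1) (.seq (.sub i i z) P)))

end Prog

namespace Runs

theorem copy {d a : ℕ} {s : State} {Q : State → Prop} (hda : d ≠ a)
    (h : ∀ s', s'.arr = s.arr → s'.reg = Function.update s.reg d (s.reg a) → Q s') :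
    Runs (.copy d a) s 2 Q := by
  refine Runs.seq (T := 1) (T' := 1) (Q := fun s' => s' = s.setReg d 0) (.const rfl) ?_
  rintro _ rfl
  refine .add (h _ rfl ?_)
  simp [State.setReg, Function.update_of_ne hda.symm]

/-- The body runs after the decrement, so with counter `x` it turns `Inv (x + 1)` into `Inv x`. The
3 extra steps per round are the test, the constant and the subtraction. -/
theorem down_loop {i z T N : ℕ} {P : Prog} (hiz : i ≠ z) (Inv : ℕ → State → Prop)
    (step : ∀ x s s', x < N → Inv (x + 1) s → s'.arr = s.arr →
      s'.reg = Function.update (Function.update s.reg z 1) i x →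
      Runs P s' T (fun s'' => s''.reg i = x ∧ Inv x s'')) :
    ∀ (x : ℕ) (s : State), x ≤ N → s.reg i = x → Inv x s →
      Runs (.loop i (.seq (.const z 1) (.seq (.sub i i z) P))) s (x * (T + 3) + 1)
        (fun s' => s'.reg i = 0 ∧ Inv 0 s') := by
  intro x
  induction x with
  | zero => exact fun s _ hx hs => ⟨s, 1, .loop_done hx, by omega, hx, hs⟩
  | succ x ih =>
    intro s hxN hx hs
    obtain ⟨s', t, he, ht, hx', hs'⟩ := step x s
      ((s.setReg z 1).setReg i x) hxN hs rfl rfl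
    obtain ⟨s'', t', he', ht', hq⟩ := ih s' (by omega) hx' hs'
    have h2 : Exec (.sub i i z) (s.setReg z 1) ((s.setReg z 1).setReg i x) 1 := by
      have h := Exec.sub (s.setReg z 1) i i z
      have h3 : (s.setReg z 1).reg i - (s.setReg z 1).reg z = x := by
        simp [State.setReg, hiz, hx]
      rwa [h3] at h
    refine ⟨s'', _, .loop_step (by omega) (.seq (.const s z 1) (.seq h2 he)) he', ?_, hq⟩
    rw [Nat.succ_mul]
    omega

theorem down {i z T N : ℕ} {P : Prog} {s : State} (hiz : i ≠ z) (hi : i ≠ 0)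
    (Inv : ℕ → State → Prop) (hN : s.reg 0 = N)
    (start : ∀ s', s'.arr = s.arr → s'.reg = Function.update s.reg i N → Inv N s')
    (step : ∀ x s s', x < N → Inv (x + 1) s → s'.arr = s.arr →
      s'.reg = Function.update (Function.update s.reg z 1) i x →
      Runs P s' T (fun s'' => s''.reg i = x ∧ Inv x s'')) :
    Runs (.down i z P) s (N * (T + 3) + 3) (fun s' => s'.reg i = 0 ∧ Inv 0 s') := by
  refine mono (Runs.seq (T := 2) (T' := N * (T + 3) + 1)
    (copy (Q := fun s' => s'.arr = s.arr ∧ s'.reg = Function.update s.reg i N) hi ?_) ?_)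
    (by omega) (fun _ h => h)
  · exact fun s' ha hr => ⟨ha, by rw [hr, hN]⟩
  · rintro s' ⟨ha, hr⟩
    exact down_loop hiz Inv step N s' le_rfl (by simp [hr]) (start s' ha hr)

end Runs

/-! ### Expressions and their compilation -/

/-- Arithmetic expressions over registers and arrays, with sums over a register that ranges over
the numbers below `r_0`. -/
inductive Expr : Type
  | const (c : ℕ) : Expr
  | var (x : ℕ) : Expr
  | add (a b : Expr) : Expr
  | sub (a b : Expr) : Expr
  | get (m : ℕ) (a : Expr) : Expr
  | sum (i : ℕ) (a : Expr) : Expr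

namespace Expr

/-- The value of an expression. -/
def eval : Expr → (ℕ → ℕ) → (ℕ → ℕ → ℕ) → ℕ
  | const c, _, _ => c
  | var x, ρ, _ => ρ x
  | add a b, ρ, A => a.eval ρ A + b.eval ρ A
  | sub a b, ρ, A => a.eval ρ A - b.eval ρ A
  | get m a, ρ, A => A m (a.eval ρ A)
  | sum i a, ρ, A => ∑ k ∈ Finset.range (ρ 0), a.eval (Function.update ρ i k) A

/-- All registers named in the expression are below `K`, and `r_0` is not bound. -/
def WF (K : ℕ) : Expr → Prop
  | const _ => True
  | var x => x < K
  | add a b => a.WF K ∧ b.WF K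
  | sub a b => a.WF K ∧ b.WF K
  | get _ a => a.WF K
  | sum i a => 0 < i ∧ i < K ∧ a.WF K

/-- A program that puts the value of the expression into `r_d`. -/
def compile : Expr → ℕ → Prog
  | const c, d => .const d c
  | var x, d => .copy d x
  | add a b, d => .seq (a.compile d) (.seq (b.compile (d + 1)) (.add d d (d + 1)))
  | sub a b, d => .seq (a.compile d) (.seq (b.compile (d + 1)) (.sub d d (d + 1)))
  | get m a, d => .seq (a.compile d) (.load d m d)
  -- The bound register is saved in `r_d` and restored at the end, so that nested sums may reuse it.
  -- The sum accumulates in `r_(d+1)`; `r_(d+2)` serves both the loop and the body.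
  | sum i a, d =>
    .seq (.copy d i) (.seq (.const (d + 1) 0)
      (.seq (.down i (d + 2) (.seq (a.compile (d + 2)) (.add (d + 1) (d + 1) (d + 2))))
        (.seq (.copy i d) (.copy d (d + 1)))))

/-- A bound for the running time of `compile`. -/
noncomputable def cost : Expr → Polynomial ℕ
  | const _ => 1
  | var _ => 2
  | add a b => a.cost + (b.cost + 1)
  | sub a b => a.cost + (b.cost + 1)
  | get _ a => a.cost + 1
  | sum _ a => 2 + (1 + (Polynomial.X * (a.cost + 1 + 3) + 3 + (2 + 2)))

theorem eval_congr {K : ℕ} (hK : 0 < K) (e : Expr) : ∀ {ρ ρ' : ℕ → ℕ} (A : ℕ → ℕ → ℕ), e.WF K →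
    (∀ x < K, ρ x = ρ' x) → e.eval ρ A = e.eval ρ' A := by
  induction e with
  | const c => intros; rfl
  | var x => intro _ _ A h hρ; exact hρ x h
  | add a b iha ihb => intro _ _ A h hρ; simp only [eval, iha A h.1 hρ, ihb A h.2 hρ]
  | sub a b iha ihb => intro _ _ A h hρ; simp only [eval, iha A h.1 hρ, ihb A h.2 hρ]
  | get m a iha => intro _ _ A h hρ; simp only [eval, iha A h hρ]
  | sum i a iha =>
    intro ρ ρ' A h hρ
    simp only [eval, hρ 0 hK]
    refine Finset.sum_congr rfl fun k _ => iha A h.2.2 fun x hx => ?_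
    by_cases hxi : x = i
    · simp [hxi]
    · simp [hxi, hρ x hx]

/-- Scratch registers start at `d`, above all registers named in the expression, so evaluating one
subexpression does not disturb another. A sum is a loop of `r_0` rounds, which keeps the cost
polynomial in `r_0`. -/
theorem runs_compile {K : ℕ} (hK : 0 < K) (e : Expr) : ∀ (d : ℕ) (s : State), e.WF K → K ≤ d →
    Runs (e.compile d) s (e.cost.eval (s.reg 0)) (fun s' => s'.arr = s.arr ∧
      (∀ x < d, s'.reg x = s.reg x) ∧ s'.reg d = e.eval s.reg s.arr) := by
  induction e with
  | const c =>
    intro d s _ _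
    simp only [cost, Polynomial.eval_one]
    refine .const ⟨rfl, fun x hx => ?_, ?_⟩
    · simp [State.setReg, hx.ne]
    · simp [State.setReg, eval]
  | var x =>
    intro d s h hd
    simp only [cost, Polynomial.eval_ofNat]
    simp only [WF] at h
    refine .copy (by omega) fun s' ha hr => ⟨ha, fun y hy => ?_, ?_⟩
    · simp [hr, hy.ne]
    · simp [hr, eval]
  | add a b iha ihb =>
    intro d s h hd
    simp only [cost, Polynomial.eval_add, Polynomial.eval_one]
    refine .seq (iha d s h.1 hd) fun s₁ ⟨ha, hr, hv⟩ => ?_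
    rw [← hr 0 (by omega)]
    refine .seq (ihb (d + 1) s₁ h.2 (by omega)) fun s₂ ⟨ha', hr', hv'⟩ => ?_
    refine .add ⟨ha'.trans ha, fun x hx => ?_, ?_⟩
    · simp [State.setReg, hx.ne, hr' x (by omega), hr x hx]
    · simp [State.setReg, hv', hr' d (by omega), hv, eval, ha,
        eval_congr hK b s.arr h.2 fun x hx => hr x (by omega)]
  | sub a b iha ihb =>
    intro d s h hd
    simp only [cost, Polynomial.eval_add, Polynomial.eval_one]
    refine .seq (iha d s h.1 hd) fun s₁ ⟨ha, hr, hv⟩ => ?_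
    rw [← hr 0 (by omega)]
    refine .seq (ihb (d + 1) s₁ h.2 (by omega)) fun s₂ ⟨ha', hr', hv'⟩ => ?_
    refine .sub ⟨ha'.trans ha, fun x hx => ?_, ?_⟩
    · simp [State.setReg, hx.ne, hr' x (by omega), hr x hx]
    · simp [State.setReg, hv', hr' d (by omega), hv, eval, ha,
        eval_congr hK b s.arr h.2 fun x hx => hr x (by omega)]
  | get m a iha =>
    intro d s h hd
    simp only [cost, Polynomial.eval_add, Polynomial.eval_one]
    refine .seq (iha d s h hd) fun s₁ ⟨ha, hr, hv⟩ => ?_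
    refine .load ⟨ha, fun x hx => ?_, ?_⟩
    · simp [State.setReg, hx.ne, hr x hx]
    · simp [State.setReg, hv, eval, ha]
  | sum i a iha =>
    intro d s ⟨hi0, hiK, h⟩ hd
    simp only [cost, Polynomial.eval_add, Polynomial.eval_one, Polynomial.eval_mul,
      Polynomial.eval_X, Polynomial.eval_ofNat]
    refine .seq (.copy (Q := fun s' => s'.arr = s.arr ∧
      s'.reg = Function.update s.reg d (s.reg i)) (by omega) fun s' ha hr => ⟨ha, hr⟩) ?_
    rintro s₁ ⟨ha₁, hr₁⟩
    refine .seq (.const (Q := fun s' => s'.arr = s.arr ∧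
      s'.reg = Function.update s₁.reg (d + 1) 0) ⟨ha₁, rfl⟩) ?_
    rintro s₂ ⟨ha₂, hr₂⟩
    have hr0 : s₂.reg 0 = s.reg 0 := by
      rw [hr₂, hr₁, Function.update_of_ne (by omega), Function.update_of_ne (by omega)]
    -- The counter descends, so the accumulator holds the terms from `x` upwards.
    refine .seq (.down (by omega) (by omega) (fun x s' => s'.arr = s.arr ∧
      (∀ y < d, y ≠ i → s'.reg y = s.reg y) ∧ s'.reg d = s.reg i ∧
      s'.reg (d + 1) = ∑ k ∈ Finset.Ico x (s.reg 0),
        a.eval (Function.update s.reg i k) s.arr) hr0 ?_ ?_) ?_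
    · intro s' ha hr
      refine ⟨ha.trans ha₂, fun y hy hyi => ?_, ?_, ?_⟩
      · rw [hr, Function.update_of_ne hyi, hr₂, hr₁, Function.update_of_ne (by omega),
          Function.update_of_ne (by omega)]
      · rw [hr, Function.update_of_ne (by omega), hr₂, hr₁, Function.update_of_ne (by omega),
          Function.update_self]
      · rw [hr, Function.update_of_ne (by omega), hr₂, Function.update_self]
        simp
    · rintro x s₃ s₄ hx ⟨ha₃, hr₃, hd₃, hv₃⟩ ha hr
      have h40 : s₄.reg 0 = s.reg 0 := by
        rw [hr, Function.update_of_ne (by omega), Function.update_of_ne (by omega),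
          hr₃ 0 (by omega) (by omega)]
      have hreg : ∀ y < d, s₄.reg y = Function.update s.reg i x y := by
        intro y hy
        by_cases hyi : y = i
        · simp [hr, hyi]
        · rw [hr, Function.update_of_ne hyi, Function.update_of_ne (by omega),
            Function.update_of_ne hyi, hr₃ y hy hyi]
      refine Runs.seq (T' := 1) (by simpa only [h40] using iha (d + 2) s₄ h (by omega)) ?_
      rintro s₅ ⟨ha₅, hr₅, hv₅⟩
      refine .add ⟨?_, ha₅.trans (ha.trans ha₃), fun y hy hyi => ?_, ?_, ?_⟩
      · simp only [State.setReg]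
        rw [Function.update_of_ne (by omega), hr₅ i (by omega), hr, Function.update_self]
      · simp only [State.setReg]
        rw [Function.update_of_ne (by omega), hr₅ y (by omega), hreg y hy,
          Function.update_of_ne hyi]
      · simp only [State.setReg]
        rw [Function.update_of_ne (by omega), hr₅ d (by omega), hr,
          Function.update_of_ne (by omega), Function.update_of_ne (by omega), hd₃]
      · simp only [State.setReg]
        rw [Function.update_self, hr₅ (d + 1) (by omega), hr, Function.update_of_ne (by omega),
          Function.update_of_ne (by omega), hv₃, hv₅, Finset.sum_eq_sum_Ico_succ_bot hx,
          add_comm, ha, ha₃, eval_congr hK a s.arr h fun y hy => hreg y (by omega)]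
    · rintro s₃ ⟨_, ha₃, hr₃, hd₃, hv₃⟩
      refine .seq (.copy (Q := fun s' => s'.arr = s.arr ∧
        s'.reg = Function.update s₃.reg i (s₃.reg d)) (by omega)
          fun s' ha hr => ⟨ha.trans ha₃, hr⟩) ?_
      rintro s₄ ⟨ha₄, hr₄⟩
      refine .copy (by omega) fun s₅ ha hr => ⟨ha.trans ha₄, fun y hy => ?_, ?_⟩
      · rw [hr, Function.update_of_ne (by omega), hr₄]
        by_cases hyi : y = i
        · simp [hyi, hd₃]
        · rw [Function.update_of_ne hyi, hr₃ y hy hyi]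
      · rw [hr, Function.update_self, hr₄, Function.update_of_ne (by omega), hv₃, eval,
          Finset.range_eq_Ico]

/-- Negation: `1` if the value is `0`, else `0`. -/
def not (a : Expr) : Expr := sub (const 1) a

/-- Conjunction. -/
def and (a b : Expr) : Expr := not (add (not a) (not b))

/-- Disjunction. -/
def or (a b : Expr) : Expr := not (not (add a b))

/-- The test `a ≤ b`. -/
def le (a b : Expr) : Expr := not (sub a b)

/-- The test `a = b`. -/
def eq (a b : Expr) : Expr := and (le a b) (le b a)

/-- Existence of a number `i` below `r_0` with `a ≠ 0`. -/
def ex (i : ℕ) (a : Expr) : Expr := not (not (sum i a))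

/-- The index of the cell `(a, b)` in a square table with `r_0` rows. -/
def idx₂ (j : ℕ) (a b : Expr) : Expr := add (sum j a) b

/-- The index of the cell `(a, b, c)` in a cubic table with `r_0` layers. -/
def idx₃ (j : ℕ) (a b c : Expr) : Expr := idx₂ j (idx₂ j a b) c

/-- The expression has a nonzero value. -/
def Holds (e : Expr) (ρ : ℕ → ℕ) (A : ℕ → ℕ → ℕ) : Prop := e.eval ρ A ≠ 0

variable {a b : Expr} {ρ : ℕ → ℕ} {A : ℕ → ℕ → ℕ} {i : ℕ}

theorem holds_not : (not a).Holds ρ A ↔ ¬ a.Holds ρ A := by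
  simp only [Holds, not, eval]; omega

theorem holds_and : (and a b).Holds ρ A ↔ a.Holds ρ A ∧ b.Holds ρ A := by
  simp only [Holds, and, not, eval]; omega

theorem holds_or : (or a b).Holds ρ A ↔ a.Holds ρ A ∨ b.Holds ρ A := by
  simp only [Holds, or, not, eval]; omega

theorem holds_le : (le a b).Holds ρ A ↔ a.eval ρ A ≤ b.eval ρ A := by
  simp only [Holds, le, not, eval]; omega

theorem holds_eq : (eq a b).Holds ρ A ↔ a.eval ρ A = b.eval ρ A := by
  simp only [eq, holds_and, holds_le]; omega

theorem holds_ex : (ex i a).Holds ρ A ↔ ∃ k < ρ 0, a.Holds (Function.update ρ i k) A := by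
  simp only [Holds, ex, not, eval]
  rw [show ∀ x : ℕ, 1 - (1 - x) ≠ 0 ↔ x ≠ 0 by omega, Ne, Finset.sum_eq_zero_iff]
  simp

open Classical in
theorem eval_not : (not a).eval ρ A = if a.Holds ρ A then 0 else 1 := by
  by_cases h : a.eval ρ A = 0
  · simp [not, eval, Holds, h]
  · simp only [not, eval, Holds, h, Ne, not_false_eq_true, if_true]
    omega

open Classical in
theorem eval_and : (and a b).eval ρ A = if (and a b).Holds ρ A then 1 else 0 := by
  rw [and, eval_not, holds_not]; split_ifs <;> rfl

open Classical in
theorem eval_or : (or a b).eval ρ A = if (or a b).Holds ρ A then 1 else 0 := by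
  simp only [or, eval_not, holds_not]
  split_ifs <;> simp_all

/-- The machine cannot multiply: the product is a sum of `r_0` equal terms, which is why `a` must
not depend on the bound register `j`. -/
theorem eval_idx₂ {j : ℕ} {N : ℕ} (h0 : ρ 0 = N)
    (ha : ∀ k, a.eval (Function.update ρ j k) A = a.eval ρ A) :
    (idx₂ j a b).eval ρ A = a.eval ρ A * N + b.eval ρ A := by
  simp [idx₂, eval, ha, h0, mul_comm]

end Expr

/-! ### Filling a cubic table -/

/-- Fills the table `m` in descending order of the cells: the cell `(r_1, r_2, r_3)` gets the
value of `e`. -/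
def Prog.fill (K m : ℕ) (e : Expr) : Prog :=
  .down 1 K (.down 2 K (.down 3 K
    (.seq ((Expr.idx₃ 4 (.var 1) (.var 2) (.var 3)).compile K)
      (.seq (e.compile (K + 1)) (.store m K (K + 1))))))

/-- A bound for the running time of `Prog.fill`. -/
noncomputable def fillCost (e : Expr) : Polynomial ℕ :=
  .X * (.X * (.X * ((Expr.idx₃ 4 (.var 1) (.var 2) (.var 3)).cost + (e.cost + 1) + 3) + 3 + 3)
    + 3 + 3) + 3

/-- The last two base-`n` digits are split off one by one. Thus storing into one cell leaves the
other cells alone. -/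
theorem index_injective {n x u v x' u' v' : ℕ} (hu : u < n) (hv : v < n) (hu' : u' < n)
    (hv' : v' < n) (h : (x * n + u) * n + v = (x' * n + u') * n + v') :
    x = x' ∧ u = u' ∧ v = v' := by
  have key : ∀ {a b a' b' : ℕ}, b < n → b' < n → a * n + b = a' * n + b' → a = a' ∧ b = b' := by
    intro a b a' b' hb hb' hab
    have h1 := congrArg (· % n) hab
    have h2 := congrArg (· / n) hab
    have hn : 0 < n := by omega
    simp only [Nat.mul_add_mod_self_right, Nat.mod_eq_of_lt hb, Nat.mod_eq_of_lt hb'] at h1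
    refine ⟨?_, h1⟩
    subst h1
    exact Nat.eq_of_mul_eq_mul_right hn (by omega)
  obtain ⟨h1, h2⟩ := key hv hv' h
  obtain ⟨h3, h4⟩ := key hu hu' h1
  exact ⟨h3, h4, h2⟩

/-- The table `m` holds the values `f` from the cell with index `p` on, and the other arrays
are those of `A`. -/
structure Filled (n m : ℕ) (A : ℕ → ℕ → ℕ) (f : ℕ → ℕ → ℕ → ℕ) (p : ℕ) (s : State) : Prop where
  size : s.reg 0 = n
  other : ∀ m', m' ≠ m → s.arr m' = A m'
  cell : ∀ x < n, ∀ u < n, ∀ v < n, p ≤ (x * n + u) * n + v →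
    s.arr m ((x * n + u) * n + v) = f x u v

theorem Filled.of_eq {n m p : ℕ} {A : ℕ → ℕ → ℕ} {f : ℕ → ℕ → ℕ → ℕ} {s s' : State}
    (h : Filled n m A f p s) (ha : s'.arr = s.arr) (h0 : s'.reg 0 = s.reg 0) :
    Filled n m A f p s' :=
  ⟨h0.trans h.size, fun m' hm' => by rw [ha, h.other m' hm'],
    fun x hx u hu v hv hp => by rw [ha, h.cell x hx u hu v hv hp]⟩

/-- When a cell is computed, all cells of larger index are already correct, so `e` may refer to
them: this is the recursion principle of the dynamic program. -/
theorem runs_fill {K n m : ℕ} (hK : 4 < K) {e : Expr} (he : e.WF K) {f : ℕ → ℕ → ℕ → ℕ}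
    {s : State} (hn : s.reg 0 = n)
    (heval : ∀ s' x u v, x < n → u < n → v < n → s'.reg 1 = x → s'.reg 2 = u → s'.reg 3 = v →
      Filled n m s.arr f ((x * n + u) * n + v + 1) s' → e.eval s'.reg s'.arr = f x u v) :
    Runs (.fill K m e) s ((fillCost e).eval n) (Filled n m s.arr f 0) := by
  simp only [fillCost, Polynomial.eval_add, Polynomial.eval_one, Polynomial.eval_mul,
      Polynomial.eval_X, Polynomial.eval_ofNat]
  refine Runs.mono (.down (by omega) (by omega)
    (fun x s' => Filled n m s.arr f (x * n * n) s') hn ?_ ?_) le_rfl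
    (fun s' h => by simpa using h.2)
  · intro s' ha hr
    refine ⟨by simp [hr, hn], fun m' _ => by rw [ha], fun x hx u hu v hv hp => ?_⟩
    -- Every index is below `n * n * n`, so at the start no cell is claimed to be filled.
    have h1 : (x + 1) * n ≤ n * n := Nat.mul_le_mul_right n hx
    have h2 : (x * n + u + 1) * n ≤ n * n * n := Nat.mul_le_mul_right n (by linarith)
    nlinarith
  intro x s₁ s₂ hx h₁ ha₂ hr₂
  have h₂ : Filled n m s.arr f ((x + 1) * n * n) s₂ :=
    h₁.of_eq ha₂ (by
      rw [hr₂, Function.update_of_ne (by omega), Function.update_of_ne (by omega)])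
  refine Runs.mono (.down (by omega) (by omega) (fun u s' => s'.reg 1 = x ∧
    Filled n m s.arr f ((x * n + u) * n) s') h₂.size ?_ ?_) le_rfl
    (fun s' h => by simpa using h.2)
  · intro s' ha hr
    refine ⟨by simp [hr, hr₂], ?_⟩
    rw [← Nat.succ_mul]
    exact h₂.of_eq ha (by simp [hr])
  rintro u s₃ s₄ hu ⟨hx₃, h₃⟩ ha₄ hr₄
  have h₄ : Filled n m s.arr f ((x * n + (u + 1)) * n) s₄ :=
    h₃.of_eq ha₄ (by
      rw [hr₄, Function.update_of_ne (by omega), Function.update_of_ne (by omega)])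
  refine Runs.mono (.down (by omega) (by omega) (fun v s' => s'.reg 1 = x ∧ s'.reg 2 = u ∧
    Filled n m s.arr f ((x * n + u) * n + v) s') h₄.size ?_ ?_) le_rfl
    (fun s' h => by simpa using ⟨h.2.2.1, h.2.1, h.2.2.2⟩)
  · intro s' ha hr
    refine ⟨?_, by simp [hr, hr₄], ?_⟩
    · rw [hr, Function.update_of_ne (by omega), hr₄, Function.update_of_ne (by omega),
        Function.update_of_ne (by omega), hx₃]
    rw [← Nat.succ_mul]
    exact h₄.of_eq ha (by simp [hr])
  rintro v s₅ s₆ hv ⟨hx₅, hu₅, h₅⟩ ha₆ hr₆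
  have h₆ : Filled n m s.arr f ((x * n + u) * n + v + 1) s₆ :=
    h₅.of_eq ha₆ (by
      rw [hr₆, Function.update_of_ne (by omega), Function.update_of_ne (by omega)])
  have hx₆ : s₆.reg 1 = x := by
    rw [hr₆, Function.update_of_ne (by omega), Function.update_of_ne (by omega), hx₅]
  have hu₆ : s₆.reg 2 = u := by
    rw [hr₆, Function.update_of_ne (by omega), Function.update_of_ne (by omega), hu₅]
  have hv₆ : s₆.reg 3 = v := by rw [hr₆, Function.update_self]
  have hidx : (Expr.idx₃ 4 (.var 1) (.var 2) (.var 3)).WF K := by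
    simp only [Expr.idx₃, Expr.idx₂, Expr.WF]; omega
  have hn₆ := h₆.size
  refine .seq (by simpa only [hn₆] using Expr.runs_compile (by omega) _ K s₆ hidx le_rfl) ?_
  rintro s₇ ⟨ha₇, hr₇, hp₇⟩
  have hp : s₇.reg K = (x * n + u) * n + v := by
    rw [hp₇, Expr.idx₃, Expr.eval_idx₂ hn₆, Expr.eval_idx₂ hn₆]
    · simp [Expr.eval, hx₆, hu₆, hv₆]
    · simp [Expr.eval]
    · simp [Expr.eval, Expr.idx₂]
  have hn₇ : s₇.reg 0 = n := (hr₇ 0 (by omega)).trans hn₆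
  refine .seq (by simpa only [hn₇] using Expr.runs_compile (by omega) e (K + 1) s₇ he (by omega)) ?_
  rintro s₈ ⟨ha₈, hr₈, hv₈⟩
  have hval : s₈.reg (K + 1) = f x u v := by
    rw [hv₈]
    exact heval s₇ x u v hx hu hv ((hr₇ 1 (by omega)).trans hx₆) ((hr₇ 2 (by omega)).trans hu₆)
      ((hr₇ 3 (by omega)).trans hv₆) (h₆.of_eq ha₇ (hr₇ 0 (by omega)))
  have hlow : ∀ y < K, s₈.reg y = s₆.reg y := fun y hy =>
    (hr₈ y (by omega)).trans (hr₇ y hy)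
  have h₈ : Filled n m s.arr f ((x * n + u) * n + v + 1) s₈ :=
    h₆.of_eq (ha₈.trans ha₇) (hlow 0 (by omega))
  refine .store ⟨(hlow 3 (by omega)).trans hv₆, (hlow 1 (by omega)).trans hx₆,
    (hlow 2 (by omega)).trans hu₆, h₈.size, fun m' hm' => ?_, fun x' hx' u' hu' v' hv' hp' => ?_⟩
  · simpa [State.setArr, hm'] using h₈.other m' hm'
  · simp only [State.setArr, Function.update_self, hr₈ K (by omega), hp, hval]
    by_cases hq : (x' * n + u') * n + v' = (x * n + u) * n + v
    · obtain ⟨rfl, rfl, rfl⟩ := index_injective hu' hv' hu hv hq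
      simp
    · rw [Function.update_of_ne hq]
      exact h₈.cell x' hx' u' hu' v' hv' (by omega)

/-! ### Incomparability graphs: convexity and distances -/

section Cocomparability

variable {V : Type*} {G : SimpleGraph V} {r : V → V → Prop}

/-- `G` is the incomparability graph of the strict partial order `r`. -/
structure IsIncompGraph (G : SimpleGraph V) (r : V → V → Prop) : Prop where
  irrefl : ∀ u, ¬ r u u
  trans : ∀ u v w, r u v → r v w → r u w
  adj : ∀ u v, u ≠ v → (G.Adj u v ↔ ¬ r u v ∧ ¬ r v u)

namespace IsIncompGraph

/-- Distances in the graph cannot tell an order from its reverse; this allows the choice of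
direction. -/
theorem swap (h : IsIncompGraph G r) : IsIncompGraph G (fun u v => r v u) :=
  ⟨h.irrefl, fun u v w huv hvw => h.trans w v u hvw huv,
    fun u v huv => (h.adj u v huv).trans and_comm⟩

theorem ne (h : IsIncompGraph G r) {u v : V} (huv : r u v) : u ≠ v := by
  rintro rfl
  exact h.irrefl u huv

theorem not_adj (h : IsIncompGraph G r) {u v : V} (huv : r u v) : ¬ G.Adj u v := fun ha =>
  ((h.adj u v (h.ne huv)).1 ha).1 huv

theorem comparable (h : IsIncompGraph G r) {u v : V} (hne : u ≠ v) (ha : ¬ G.Adj u v) :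
    r u v ∨ r v u := by
  by_contra hc
  exact ha ((h.adj u v hne).2 (not_or.1 hc))

/-- Closed neighbourhoods are convex. -/
theorem dominates_between (h : IsIncompGraph G r) {a z b y : V} (haz : r a z) (hzb : r z b)
    (ha : a = y ∨ G.Adj y a) (hb : b = y ∨ G.Adj y b) : z = y ∨ G.Adj y z := by
  by_contra hc
  rw [not_or] at hc
  rcases h.comparable (Ne.symm hc.1) hc.2 with hyz | hzy
  · have hyb := h.trans _ _ _ hyz hzb
    rcases hb with rfl | hb
    · exact h.irrefl _ hyb
    · exact h.not_adj hyb hb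
  · have hay := h.trans _ _ _ haz hzy
    rcases ha with rfl | ha
    · exact h.irrefl _ hay
    · exact h.not_adj hay ha.symm

/-- Distinct vertices of an independent set are comparable, so a minimal one is least. -/
theorem exists_least [Finite V] (h : IsIncompGraph G r) {A : Finset V} (hA : A.Nonempty)
    (hind : G.IsIndepSet (A : Set V)) : ∃ a ∈ A, ∀ x ∈ A, x ≠ a → r a x := by
  have : IsTrans V r := ⟨h.trans⟩
  have : Std.Irrefl r := ⟨h.irrefl⟩
  obtain ⟨a, ha, hmin⟩ := (Finite.wellFounded_of_trans_of_irrefl r).has_min (A : Set V) hA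
  refine ⟨a, ha, fun x hx hne => ?_⟩
  exact (h.comparable hne.symm (hind ha hx hne.symm)).resolve_right (hmin x hx)

/-- A walk between two vertices meets the closed neighbourhood of each vertex between them. -/
theorem exists_walks_between (h : IsIncompGraph G r) {a c : V} (p : G.Walk a c) {b : V}
    (hab : r a b) (hbc : r b c) : ∃ y, (y = b ∨ G.Adj y b) ∧
      ∃ (q : G.Walk a y) (q' : G.Walk y c), q.length + q'.length = p.length := by
  induction p with
  | nil => exact absurd (h.trans _ _ _ hab hbc) (h.irrefl _)
  | @cons a a' c ha p ih =>
    by_cases hy : a' = b ∨ G.Adj a' b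
    · exact ⟨a', hy, .cons ha .nil, p, by simp [add_comm]⟩
    · rw [not_or] at hy
      -- An edge cannot jump over `b`: a neighbour of `a` above `b` would be above `a`.
      have hab' : r a' b := (h.comparable hy.1 hy.2).resolve_right fun hba =>
        h.not_adj (h.trans _ _ _ hab hba) ha
      obtain ⟨y, hy, q, q', hl⟩ := ih hab' hbc
      exact ⟨y, hy, .cons ha q, q', by simp only [SimpleGraph.Walk.length_cons]; omega⟩

/-- A shortest walk from `a` to `c` passes through the closed neighbourhood of `b`; the detour to
`b` and back costs at most 2. -/
theorem dist_between (h : IsIncompGraph G r) {a b c : V} (hab : r a b) (hbc : r b c)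
    (hac : G.Reachable a c) : G.dist a b + G.dist b c ≤ G.dist a c + 2 := by
  obtain ⟨p, hp⟩ := hac.exists_walk_length_eq_dist
  obtain ⟨y, hy, q, q', hl⟩ := h.exists_walks_between p hab hbc
  have h1 := SimpleGraph.dist_le q
  have h2 := SimpleGraph.dist_le q'
  have h3 := q.reachable.dist_triangle_left b
  have h4 := q'.reachable.dist_triangle_right b
  have h5 : G.dist y b ≤ 1 := by
    rcases hy with rfl | hy
    · simp
    · exact (SimpleGraph.dist_eq_one_iff_adj.2 hy).le
  rw [SimpleGraph.dist_comm (u := b) (v := y)] at h4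
  omega

end IsIncompGraph

theorem not_two_lt_edist {a b : V} (h : ¬ 2 < G.edist a b) :
    ∃ y, (a = y ∨ G.Adj y a) ∧ (b = y ∨ G.Adj y b) := by
  rw [SimpleGraph.two_lt_edist_iff] at h
  by_cases hab : a = b
  · exact ⟨a, .inl rfl, .inl hab.symm⟩
  by_cases hadj : G.Adj a b
  · exact ⟨a, .inl rfl, .inr hadj⟩
  obtain ⟨y, hy⟩ := Set.nonempty_iff_ne_empty.2 fun hc => h ⟨hab, hadj, hc⟩
  rw [SimpleGraph.mem_commonNeighbors] at hy
  exact ⟨y, .inr hy.1.symm, .inr hy.2.symm⟩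

theorem two_lt_edist_iff_dist {a b : V} (h : G.Reachable a b) :
    2 < G.edist a b ↔ 2 < G.dist a b := by
  rw [← h.coe_dist_eq_edist]
  exact_mod_cast Iff.rfl

/-! ### Packings and the min-max theorem -/

/-- The vertices of `S` have pairwise distance at least `3`. -/
def IsPacking (G : SimpleGraph V) (S : Finset V) : Prop :=
  ∀ a ∈ S, ∀ b ∈ S, a ≠ b → 2 < G.edist a b

theorem IsPacking.mono {S T : Finset V} (hT : IsPacking G T) (h : S ⊆ T) : IsPacking G S :=
  fun a ha b hb => hT a (h ha) b (h hb)

theorem IsPacking.isIndepSet {S : Finset V} (hS : IsPacking G S) :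
    G.IsIndepSet (S : Set V) := fun a ha b hb hab =>
  (SimpleGraph.two_lt_edist_iff.1 (hS a ha b hb hab)).2.1

theorem IsPacking.insert [DecidableEq V] {S : Finset V} {a : V} (hS : IsPacking G S)
    (ha : ∀ b ∈ S, 2 < G.edist a b) : IsPacking G (insert a S) := by
  intro x hx y hy hxy
  rw [Finset.mem_insert] at hx hy
  rcases hx with rfl | hx <;> rcases hy with rfl | hy
  · exact absurd rfl hxy
  · exact ha y hy
  · rw [SimpleGraph.edist_comm]; exact ha x hx
  · exact hS x hx y hy hxy

/-- A closed neighbourhood contains at most one vertex of a packing, so choosing dominators is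
injective. -/
theorem IsPacking.card_le_of_dominates {S D : Finset V} (hS : IsPacking G S)
    (hD : Dominates G D S) : S.card ≤ D.card := by
  choose! f hf hf' using hD
  refine Finset.card_le_card_of_injOn f hf fun a ha b hb hab => ?_
  by_contra hne
  have h := hS a ha b hb hne
  have ha' := hf' a ha
  have hb' := hf' b hb
  rw [hab] at ha'
  have hle : ∀ c, c = f b ∨ G.Adj (f b) c → G.edist c (f b) ≤ 1 := fun c hc =>
    SimpleGraph.edist_le_one_iff_adj_or_eq.2 (hc.symm.imp_left SimpleGraph.Adj.symm)
  have h2 : G.edist a b ≤ 1 + 1 := SimpleGraph.edist_triangle.trans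
    (add_le_add (hle a ha') (by rw [SimpleGraph.edist_comm]; exact hle b hb'))
  rw [one_add_one_eq_two] at h2
  exact absurd h h2.not_gt

theorem domNumber_le {A D : Finset V} (h : Dominates G D A) : domNumber G A ≤ D.card :=
  Nat.sInf_le ⟨D, h, rfl⟩

theorem exists_dominates (A : Finset V) : ∃ D, Dominates G D A ∧ D.card = domNumber G A :=
  Nat.sInf_mem (s := {k | ∃ D : Finset V, Dominates G D A ∧ D.card = k})
    ⟨_, A, fun b hb => ⟨b, hb, .inl rfl⟩, rfl⟩

/-- An independent set contains a packing and is dominated by a set of at most its size. -/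
theorem IsIncompGraph.exists_packing_dominates [Fintype V] (h : IsIncompGraph G r) (A : Finset V)
    (hA : G.IsIndepSet (A : Set V)) :
    ∃ S ⊆ A, ∃ D, IsPacking G S ∧ Dominates G D A ∧ D.card ≤ S.card := by
  classical
  induction A using Finset.strongInduction with
  | H A ih =>
  rcases A.eq_empty_or_nonempty with rfl | hne
  · exact ⟨∅, subset_rfl, ∅, by simp [IsPacking], by simp [Dominates], le_rfl⟩
  obtain ⟨a, haA, hmin⟩ := h.exists_least hne hA
  -- Greedy choice: among the vertices dominating the least vertex `a`, `x` dominates the most of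
  -- `A`. The induction continues with what `x` misses.
  obtain ⟨x, hx, hmax⟩ := Finset.exists_max_image
    (Finset.univ.filter fun x => a = x ∨ G.Adj x a)
    (fun x => (A.filter fun b => b = x ∨ G.Adj x b).card) ⟨a, by simp⟩
  simp only [Finset.mem_filter, Finset.mem_univ, true_and] at hx hmax
  have hsub : (A.filter fun b => ¬ (b = x ∨ G.Adj x b)) ⊆ A := Finset.filter_subset _ _
  obtain ⟨S, hS, D, hpack, hdom, hcard⟩ := ih (A.filter fun b => ¬ (b = x ∨ G.Adj x b))
    (Finset.filter_ssubset.2 ⟨a, haA, not_not.2 hx⟩) (hA.mono (by exact_mod_cast hsub))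
  have haS : a ∉ S := fun ha => (Finset.mem_filter.1 (hS ha)).2 hx
  refine ⟨insert a S, Finset.insert_subset haA (hS.trans hsub), insert x D,
    hpack.insert fun b hb => ?_, fun b hb => ?_, ?_⟩
  · obtain ⟨hbA, hbx⟩ := Finset.mem_filter.1 (hS hb)
    by_contra hc
    obtain ⟨y, hya, hyb⟩ := not_two_lt_edist hc
    have hba : b ≠ a := fun hba => hbx (hba ▸ hx)
    have hab := hmin b hbA hba
    -- By convexity, `y` dominates all of `A` from `a` to `b`, whereas `x`, which misses `b`,
    -- dominates nothing in `A` beyond `b`. So `y` would beat `x`.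
    refine absurd (hmax y hya) (not_le.2 (Finset.card_lt_card ?_))
    refine (Finset.ssubset_iff_of_subset fun z hz => ?_).2
      ⟨b, Finset.mem_filter.2 ⟨hbA, hyb⟩, fun hb' => hbx (Finset.mem_filter.1 hb').2⟩
    obtain ⟨hzA, hzx⟩ := Finset.mem_filter.1 hz
    refine Finset.mem_filter.2 ⟨hzA, ?_⟩
    have hzb : z ≠ b := fun hzb => hbx (hzb ▸ hzx)
    rcases h.comparable hzb (hA hzA hbA hzb) with hr | hr
    · by_cases hza : z = a
      · rwa [hza]
      · exact h.dominates_between (hmin z hzA hza) hr hya hyb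
    · exact absurd (h.dominates_between hab hr hx hzx) hbx
  · by_cases hbx : b = x ∨ G.Adj x b
    · exact ⟨x, Finset.mem_insert_self _ _, hbx⟩
    · obtain ⟨d, hd, hbd⟩ := hdom b (Finset.mem_filter.2 ⟨hb, hbx⟩)
      exact ⟨d, Finset.mem_insert_of_mem hd, hbd⟩
  · rw [Finset.card_insert_of_notMem haS]
    exact (Finset.card_insert_le _ _).trans (by omega)

theorem bddAbove_domNumber [Fintype V] :
    BddAbove {k | ∃ A : Finset V, G.IsIndepSet (A : Set V) ∧ domNumber G A = k} := by
  refine ⟨Fintype.card V, ?_⟩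
  rintro _ ⟨A, _, rfl⟩
  exact (domNumber_le fun b hb => ⟨b, hb, .inl rfl⟩).trans (Finset.card_le_univ A)

theorem IsPacking.card_le_indepDomNumber [Fintype V] {S : Finset V} (hS : IsPacking G S) :
    S.card ≤ indepDomNumber G := by
  obtain ⟨D, hD, hc⟩ := exists_dominates (G := G) S
  exact (hS.card_le_of_dominates hD).trans
    (hc.trans_le (le_csSup bddAbove_domNumber ⟨S, hS.isIndepSet, rfl⟩))

theorem IsIncompGraph.exists_packing_card [Fintype V] (h : IsIncompGraph G r) :
    ∃ S, IsPacking G S ∧ indepDomNumber G ≤ S.card := by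
  obtain ⟨A, hA, hc⟩ := Nat.sSup_mem
    (s := {k | ∃ A : Finset V, G.IsIndepSet (A : Set V) ∧ domNumber G A = k})
    ⟨_, ∅, by simp [SimpleGraph.IsIndepSet], rfl⟩ bddAbove_domNumber
  obtain ⟨S, -, D, hS, hD, hle⟩ := h.exists_packing_dominates A hA
  exact ⟨S, hS, hc.symm.trans_le ((domNumber_le hD).trans hle)⟩

/-! ### Packings as chains of steps -/

/-- `c` and `b` are far apart, and `c` lies between `s` and `b` as far as distances tell. -/
def Step (G : SimpleGraph V) (s c b : V) : Prop :=
  G.Reachable s b ∧ 2 < G.dist c b ∧ G.dist s c + G.dist c b ≤ G.dist s b + 2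

/-- `k` steps lead from `s` to `b`. -/
def Chain (G : SimpleGraph V) : ℕ → V → V → Prop
  | 0, s, b => s = b
  | k + 1, s, b => ∃ c, Chain G k s c ∧ Step G s c b

/-- The first step fixes `r'` as `r` or its reverse, and the distance inequality keeps later steps
from turning back. Carrying `2 < G.dist s b` and the maximality of `b` through the induction makes
this work. -/
theorem IsIncompGraph.exists_packing_of_chain (h : IsIncompGraph G r) {k : ℕ} {s b : V}
    (hk : Chain G k s b) : (k = 0 ∧ s = b) ∨ ∃ r', IsIncompGraph G r' ∧ r' s b ∧ 2 < G.dist s b ∧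
      ∃ S, IsPacking G S ∧ S.card = k + 1 ∧ b ∈ S ∧ (∀ x ∈ S, G.Reachable s x) ∧
        ∀ x ∈ S, x ≠ b → r' x b := by
  classical
  induction k generalizing b with
  | zero => exact .inl ⟨rfl, hk⟩
  | succ k ih =>
    right
    obtain ⟨c, hc, hsb, hcb, hd⟩ := hk
    have hfar : ∀ {u v : V}, 2 < G.dist u v → u ≠ v ∧ ¬ G.Adj u v := fun {u v} huv =>
      ⟨fun e => by simp [e] at huv, fun e => by
        rw [SimpleGraph.dist_eq_one_iff_adj.2 e] at huv; omega⟩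
    rcases ih hc with ⟨rfl, rfl⟩ | ⟨r', h', hsc, hdsc, S, hS, hcard, hcS, hreach, hmax⟩
    · have key : ∃ r', IsIncompGraph G r' ∧ r' s b := by
        rcases h.comparable (hfar hcb).1 (hfar hcb).2 with hr | hr
        · exact ⟨r, h, hr⟩
        · exact ⟨_, h.swap, hr⟩
      obtain ⟨r', h', hr⟩ := key
      refine ⟨r', h', hr, hcb, insert b {s}, ?_, ?_, by simp, ?_, ?_⟩
      · refine IsPacking.insert (by simp [IsPacking]) fun x hx => ?_
        rw [Finset.mem_singleton] at hx
        rw [hx, SimpleGraph.edist_comm, two_lt_edist_iff_dist hsb]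
        exact hcb
      · rw [Finset.card_insert_of_notMem (by simpa using (hfar hcb).1.symm)]
        simp
      · simp [hsb]
      · simp [hr]
    · have hrcb : r' c b := by
        refine (h'.comparable (hfar hcb).1 (hfar hcb).2).resolve_right fun hbc => ?_
        have hdsb : 2 < G.dist s b := by omega
        have e1 := G.dist_comm (u := b) (v := c)
        have e2 := G.dist_comm (u := b) (v := s)
        -- Suppose `b` precedes `c`. Add the inequality of the step to `dist_between` for `s, b, c`
        -- or for `b, s, c`: the result is `d(c,b) ≤ 2` or `d(s,c) ≤ 2`, and both are excluded.
        rcases h'.comparable (hfar hdsb).1 (hfar hdsb).2 with hr | hr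
        · have := h'.dist_between hr hbc (hreach c hcS)
          omega
        · have := h'.dist_between hr hsc (hsb.symm.trans (hreach c hcS))
          omega
      have hlt : ∀ x ∈ S, r' x b := fun x hx => by
        by_cases hxc : x = c
        · rwa [hxc]
        · exact h'.trans _ _ _ (hmax x hx hxc) hrcb
      refine ⟨r', h', h'.trans _ _ _ hsc hrcb, by omega, insert b S, hS.insert fun x hx => ?_, ?_,
        Finset.mem_insert_self _ _, ?_, ?_⟩
      · have hxb : G.Reachable x b := (hreach x hx).symm.trans hsb
        rw [SimpleGraph.edist_comm, two_lt_edist_iff_dist hxb]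
        by_cases hxc : x = c
        · rwa [hxc]
        -- Both parts of the way over `c` are at least 3, so `d(x,b) ≥ 3 + 3 - 2`.
        · have h1 := h'.dist_between (hmax x hx hxc) hrcb hxb
          have h2 := (two_lt_edist_iff_dist ((hreach x hx).symm.trans (hreach c hcS))).1
            (hS x hx c hcS hxc)
          omega
      · rw [Finset.card_insert_of_notMem fun hb => h'.irrefl b (hlt b hb), hcard]
      · simpa [hsb] using hreach
      · intro x hx hxb
        exact hlt x ((Finset.mem_insert.1 hx).resolve_left hxb)

/-- List the packing in the order `r`: consecutive vertices form steps by `dist_between`. The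
induction removes the greatest vertex. -/
theorem IsIncompGraph.exists_chain_of_packing [Finite V] (h : IsIncompGraph G r) {k : ℕ}
    {S : Finset V} (hS : IsPacking G S) (hcard : S.card = k + 1)
    (hreach : ∀ x ∈ S, ∀ y ∈ S, G.Reachable x y) :
    ∃ s ∈ S, ∃ b ∈ S, Chain G k s b ∧ (∀ x ∈ S, x ≠ s → r s x) ∧ ∀ x ∈ S, x ≠ b → r x b := by
  classical
  induction k generalizing S with
  | zero =>
    obtain ⟨s, rfl⟩ := Finset.card_eq_one.1 hcard
    exact ⟨s, by simp, s, by simp, rfl, by simp, by simp⟩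
  | succ k ih =>
    obtain ⟨b, hb, hmax⟩ := h.swap.exists_least (Finset.card_pos.1 (by omega)) hS.isIndepSet
    have hsub := Finset.erase_subset b S
    obtain ⟨s, hs, c, hc, hchain, hmin, hmax'⟩ := ih (hS.mono hsub)
      (by rw [Finset.card_erase_of_mem hb]; omega)
      (fun x hx y hy => hreach x (hsub hx) y (hsub hy))
    rw [Finset.mem_erase] at hs hc
    refine ⟨s, hs.2, b, hb, ⟨c, hchain, hreach s hs.2 b hb, ?_, ?_⟩, ?_, hmax⟩
    · exact (two_lt_edist_iff_dist (hreach c hc.2 b hb)).1 (hS c hc.2 b hb hc.1)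
    · by_cases hsc : s = c
      · simp [hsc]
      · exact h.dist_between (hmax' s (Finset.mem_erase.2 hs) hsc) (hmax c hc.2 hc.1)
          (hreach s hs.2 b hb)
    · intro x hx hxs
      by_cases hxb : x = b
      · rw [hxb]; exact hmax s hs.2 hs.1
      · exact hmin x (Finset.mem_erase.2 ⟨hxb, hx⟩) hxs

open Classical in
/-- The formula that the program evaluates: each component, represented by its least vertex,
contributes the number of `k` for which it contains a chain of `k` steps. -/
theorem IsIncompGraph.indepDomNumber_eq [Fintype V] [LinearOrder V] (h : IsIncompGraph G r) :
    indepDomNumber G = ∑ v : V, ∑ k ∈ Finset.range (Fintype.card V),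
      if (∀ q < v, ¬ G.Reachable v q) ∧ ∃ s b, G.Reachable v s ∧ Chain G k s b
        then 1 else 0 := by
  have hex : ∀ v : V, ∃ S, (IsPacking G S ∧ ∀ x ∈ S, G.Reachable v x) ∧
      ∀ S', (IsPacking G S' ∧ ∀ x ∈ S', G.Reachable v x) → S'.card ≤ S.card := by
    intro v
    obtain ⟨S, hS, hmax⟩ := Finset.exists_max_image (Finset.univ.filter fun S : Finset V =>
      IsPacking G S ∧ ∀ x ∈ S, G.Reachable v x) Finset.card
      ⟨∅, Finset.mem_filter.2 ⟨Finset.mem_univ _, by simp [IsPacking]⟩⟩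
    simp only [Finset.mem_filter, Finset.mem_univ, true_and] at hS hmax
    exact ⟨S, hS, hmax⟩
  choose S hS hmax using hex
  -- Subsets of packings are packings, so the possible `k` form an initial segment, and counting
  -- them gives the maximum size in the component.
  have hchain : ∀ v k, (∃ s b, G.Reachable v s ∧ Chain G k s b) ↔ k < (S v).card := by
    intro v k
    constructor
    · rintro ⟨s, b, hvs, hk⟩
      rcases h.exists_packing_of_chain hk with ⟨rfl, -⟩ | ⟨r', -, -, -, T, hT, hc, -, hreach, -⟩
      · exact hmax v {v} ⟨by simp [IsPacking], by simp⟩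
      · have := hmax v T ⟨hT, fun x hx => hvs.trans (hreach x hx)⟩
        omega
    · intro hk
      obtain ⟨T, hT, hc⟩ := Finset.exists_subset_card_eq (Nat.succ_le_of_lt hk)
      obtain ⟨s, hs, b, -, hsb, -⟩ := h.exists_chain_of_packing ((hS v).1.mono hT) hc
        fun x hx y hy => ((hS v).2 x (hT hx)).symm.trans ((hS v).2 y (hT hy))
      exact ⟨s, b, (hS v).2 s (hT hs), hsb⟩
  have hsum : ∀ v, (∑ k ∈ Finset.range (Fintype.card V),
      if (∀ q < v, ¬ G.Reachable v q) ∧ ∃ s b, G.Reachable v s ∧ Chain G k s b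
        then 1 else 0) = if ∀ q < v, ¬ G.Reachable v q then (S v).card else 0 := by
    intro v
    split_ifs with hv
    · simp only [fun k => (and_iff_right hv).trans (hchain v k)]
      rw [← Finset.card_filter]
      conv_rhs => rw [← Finset.card_range (S v).card]
      congr 1
      ext k
      have := Finset.card_le_univ (S v)
      simp only [Finset.mem_filter, Finset.mem_range]
      omega
    · simp [hv]
  simp only [hsum]
  rw [← Finset.sum_filter]
  -- A packing splits into its parts in the components; conversely, the union of packings of
  -- different components is a packing, since `edist` is infinite between them.
  apply le_antisymm
  · obtain ⟨T, hT, hle⟩ := h.exists_packing_card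
    have hcover : T ⊆ (Finset.univ.filter fun v => ∀ q < v, ¬ G.Reachable v q).biUnion
        fun v => T.filter fun x => G.Reachable v x := by
      intro x hx
      obtain ⟨v, hv, hmin⟩ := Finset.exists_min_image
        (Finset.univ.filter fun v => G.Reachable v x) id ⟨x, by simp⟩
      simp only [Finset.mem_filter, Finset.mem_univ, true_and, id] at hv hmin
      refine Finset.mem_biUnion.2 ⟨v, ?_, Finset.mem_filter.2 ⟨hx, hv⟩⟩
      simp only [Finset.mem_filter, Finset.mem_univ, true_and]
      exact fun q hq hvq => absurd (hmin q (hvq.symm.trans hv)) (not_le.2 hq)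
    refine hle.trans ((Finset.card_le_card hcover).trans (Finset.card_biUnion_le.trans ?_))
    refine Finset.sum_le_sum fun v _ => hmax v _ ⟨hT.mono (Finset.filter_subset _ _), ?_⟩
    exact fun x hx => (Finset.mem_filter.1 hx).2
  · have hsep : ∀ v w x y, (∀ q < v, ¬ G.Reachable v q) → (∀ q < w, ¬ G.Reachable w q) →
        x ∈ S v → y ∈ S w → G.Reachable x y → v = w := by
      intro v w x y hv hw hx hy hxy
      have hvw : G.Reachable v w := ((hS v).2 x hx).trans (hxy.trans ((hS w).2 y hy).symm)
      by_contra hne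
      rcases lt_or_gt_of_ne hne with hlt | hlt
      · exact hw v hlt hvw.symm
      · exact hv w hlt hvw
    rw [← Finset.card_biUnion]
    · refine IsPacking.card_le_indepDomNumber fun x hx y hy hxy => ?_
      simp only [Finset.mem_biUnion, Finset.mem_filter, Finset.mem_univ, true_and] at hx hy
      obtain ⟨v, hv, hx⟩ := hx
      obtain ⟨w, hw, hy⟩ := hy
      by_cases hr : G.Reachable x y
      · obtain rfl := hsep v w x y hv hw hx hy hr
        exact (hS v).1 x hx y hy hxy
      · rw [SimpleGraph.edist_eq_top_of_not_reachable hr]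
        exact ENat.natCast_lt_top 2
    · intro v hv w hw hne
      simp only [Finset.coe_filter, Finset.mem_univ, true_and, Set.mem_ofPred_eq] at hv hw
      exact Finset.disjoint_left.2 fun x hx hx' => hne (hsep v w x x hv hw hx hx' .rfl)

/-! ### Permutation diagrams -/

/-- The coordinates of the segments of a permutation diagram, ordered in both lines, form an
order with `G` as incomparability graph. -/
theorem IsPermutationGraph.exists_isIncompGraph (h : IsPermutationGraph G) :
    ∃ r, IsIncompGraph G r := by
  obtain ⟨top, bot, h⟩ := h
  refine ⟨fun u v => top u < top v ∧ bot u < bot v, fun u hu => lt_irrefl _ hu.1,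
    fun u v w huv hvw => ⟨huv.1.trans hvw.1, huv.2.trans hvw.2⟩, fun u v huv => ?_⟩
  rw [h, and_iff_right huv]
  constructor
  · rintro ⟨p, ⟨a, b, ha, hb, hab, rfl⟩, ⟨a', b', ha', hb', hab', hp⟩⟩
    simp only [Prod.smul_mk, Prod.mk_add_mk, smul_eq_mul, Prod.mk.injEq] at hp
    obtain rfl : a' = a := by linarith
    obtain rfl : b' = b := by linarith
    have hpos : 0 < a' ∨ 0 < b' := by
      by_contra hc
      rw [not_or] at hc
      linarith
    constructor <;> rintro ⟨h1, h2⟩ <;> rcases hpos with hpos | hpos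
    · nlinarith [mul_lt_mul_of_pos_left h1 hpos, mul_le_mul_of_nonneg_left h2.le hb]
    · nlinarith [mul_le_mul_of_nonneg_left h1.le ha, mul_lt_mul_of_pos_left h2 hpos]
    · nlinarith [mul_lt_mul_of_pos_left h1 hpos, mul_le_mul_of_nonneg_left h2.le hb]
    · nlinarith [mul_le_mul_of_nonneg_left h1.le ha, mul_lt_mul_of_pos_left h2 hpos]
  · rintro ⟨h1, h2⟩
    have key : ∃ a b : ℝ, 0 ≤ a ∧ 0 ≤ b ∧ a + b = 1 ∧
        a * top u + b * bot u = a * top v + b * bot v := by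
      rcases eq_or_ne (top u) (top v) with ht | ht
      · exact ⟨1, 0, by simp [ht]⟩
      have hopp : (top u - top v) * (bot u - bot v) ≤ 0 := by
        rw [not_and, not_lt] at h1 h2
        rcases lt_or_gt_of_ne ht with hlt | hlt
        · exact mul_nonpos_of_nonpos_of_nonneg (by linarith) (by linarith [h1 hlt])
        · exact mul_nonpos_of_nonneg_of_nonpos (by linarith) (by linarith [h2 hlt])
      have hne : |top u - top v| ≠ 0 := abs_ne_zero.2 (sub_ne_zero.2 ht)
      have hpos : 0 < |top u - top v| + |bot u - bot v| := by positivity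
      -- The differences on the two lines do not have the same sign, so weighting each by the
      -- absolute value of the other makes them cancel.
      refine ⟨|bot u - bot v| / (|top u - top v| + |bot u - bot v|),
        |top u - top v| / (|top u - top v| + |bot u - bot v|), by positivity, by positivity, ?_, ?_⟩
      · field_simp
        ring
      · field_simp
        rcases lt_or_gt_of_ne ht with hlt | hlt
        · have : 0 ≤ bot u - bot v := by nlinarith
          rw [abs_of_nonneg this, abs_of_neg (by linarith)]
          ring
        · have : bot u - bot v ≤ 0 := by nlinarith
          rw [abs_of_nonpos this, abs_of_pos (by linarith)]
          ring
    obtain ⟨a, b, ha, hb, hab, he⟩ := key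
    exact ⟨a • (top u, 1) + b • (bot u, 0), ⟨a, b, ha, hb, hab, rfl⟩,
      ⟨a, b, ha, hb, hab, by simp [he]⟩⟩

end Cocomparability

/-! ### The expressions of the algorithm -/

namespace Expr

/-- The cell `(a, b, c)` of the cubic table `m`. -/
def cell (m : ℕ) (a b c : Expr) : Expr := get m (idx₃ 4 a b c)

/-- The test whether `r_1` is the last layer of a table. -/
def last : Expr := le (var 0) (add (var 1) (const 1))

/-- The entry `(r_1, r_2, r_3)` of the table `m`, whose last layer is the identity, and in which
each other layer is obtained from the next one by the step `st` from `r_5` to `r_3`. -/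
def entry (m : ℕ) (st : Expr) : Expr :=
  or (and last (eq (var 2) (var 3)))
    (and (not last) (ex 5 (and (cell m (add (var 1) (const 1)) (var 2) (var 5)) st)))

/-- Equality or adjacency of `r_5` and `r_3`. -/
def adjStep : Expr := or (eq (var 5) (var 3)) (get 0 (idx₂ 4 (var 5) (var 3)))

/-- The test whether table `1` connects `r_p` with `r_q`. -/
def reach (p q : ℕ) : Expr := ex 6 (cell 1 (var 6) (var p) (var q))

/-- The distance of `r_p` and `r_q` according to table `1`. -/
def dist (p q : ℕ) : Expr := sum 6 (not (cell 1 (var 6) (var p) (var q)))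

/-- The test for `Step` on `r_2`, `r_5`, `r_3`. -/
def farStep : Expr :=
  and (reach 2 3) (and (le (const 3) (dist 5 3))
    (le (add (dist 2 5) (dist 5 3)) (add (dist 2 3) (const 2))))

/-- The independence-domination number, computed from the tables `1` and `2`. -/
def result : Expr :=
  sum 1 (sum 2 (and (not (ex 3 (and (not (le (var 1) (var 3))) (reach 1 3))))
    (ex 3 (ex 5 (and (reach 1 3) (cell 2 (var 2) (var 3) (var 5)))))))

theorem eval_cell {m N : ℕ} {a b c : Expr} {ρ : ℕ → ℕ} {A : ℕ → ℕ → ℕ} (h0 : ρ 0 = N)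
    (ha : ∀ k, a.eval (Function.update ρ 4 k) A = a.eval ρ A)
    (hb : ∀ k, b.eval (Function.update ρ 4 k) A = b.eval ρ A) :
    (cell m a b c).eval ρ A = A m ((a.eval ρ A * N + b.eval ρ A) * N + c.eval ρ A) := by
  rw [cell, eval, idx₃, eval_idx₂ h0, eval_idx₂ h0 ha]
  intro k
  simp only [idx₂, eval, hb]
  simp only [Function.update_idem, ha, ne_eq, OfNat.zero_ne_ofNat, not_false_eq_true,
    Function.update_of_ne]

end Expr

variable {n : ℕ}

/-- The array `m` of `A` holds the relations `R 0, …, R (n - 1)` in reverse order. -/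
def IsTable (m : ℕ) (R : ℕ → Fin n → Fin n → Prop) (A : ℕ → ℕ → ℕ) : Prop :=
  ∀ x < n, ∀ u v : Fin n, A m ((x * n + u) * n + v) ≠ 0 ↔ R (n - 1 - x) u v

/-- Tables are filled downwards, so `R 0` sits in the last layer and each layer reads the next one.
The test `st` need only be right where `R k u w` holds, because `entry` takes its conjunction with
that cell. -/
theorem runs_entry {K m : ℕ} (hK : 5 < K) {st : Expr} (hst : st.WF K) {s : State}
    (hn : s.reg 0 = n) {R : ℕ → Fin n → Fin n → Prop} {T : Fin n → Fin n → Fin n → Prop}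
    (hzero : ∀ u v, R 0 u v ↔ u = v)
    (hsucc : ∀ k u v, R (k + 1) u v ↔ ∃ w, R k u w ∧ T u w v)
    (hstep : ∀ ρ A (u w v : Fin n) k, (∀ m', m' ≠ m → A m' = s.arr m') → ρ 0 = n →
      ρ 2 = (u : ℕ) → ρ 5 = (w : ℕ) → ρ 3 = (v : ℕ) → R k u w → (st.Holds ρ A ↔ T u w v)) :
    Runs (.fill K m (.entry m st)) s ((fillCost (.entry m st)).eval n)
      (fun s' => s'.reg 0 = n ∧ (∀ m', m' ≠ m → s'.arr m' = s.arr m') ∧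
        IsTable m R s'.arr) := by
  classical
  let f : ℕ → ℕ → ℕ → ℕ := fun x u v =>
    if ∃ (hu : u < n) (hv : v < n), R (n - 1 - x) ⟨u, hu⟩ ⟨v, hv⟩ then 1 else 0
  have hf : ∀ x (u v : Fin n), f x u v ≠ 0 ↔ R (n - 1 - x) u v := fun x u v => by
    simp [f]
  have hwf : (Expr.entry m st).WF K := by
    simp only [Expr.entry, Expr.or, Expr.and, Expr.not, Expr.last, Expr.le, Expr.eq, Expr.ex,
      Expr.cell, Expr.idx₃, Expr.idx₂, Expr.WF, hst, and_true, true_and]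
    omega
  refine (runs_fill (f := f) (by omega) hwf hn ?_).mono le_rfl fun s' h =>
    ⟨h.size, h.other, fun x hx u v => ?_⟩
  · intro s' x u v hx hu hv h1 h2 h3 hfill
    rw [Expr.entry, Expr.eval_or]
    refine if_congr ?_ rfl rfl
    simp only [Expr.holds_or, Expr.holds_and, Expr.holds_not, Expr.holds_ex, Expr.last,
      Expr.holds_le, Expr.holds_eq, Expr.eval, h1, h2, h3, hfill.size]
    rcases Nat.lt_or_ge (x + 1) n with hlt | hge
    · obtain ⟨k, hk⟩ : ∃ k, n - 1 - x = k + 1 := ⟨n - 1 - x - 1, by omega⟩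
      have hk' : n - 1 - (x + 1) = k := by omega
      have hmem : ∀ w : Fin n, (Expr.cell m ((Expr.var 1).add (.const 1)) (.var 2) (.var 5)).Holds
          (Function.update s'.reg 5 w) s'.arr ↔ R k ⟨u, hu⟩ w := by
        intro w
        have h0 : Function.update s'.reg 5 w.1 0 = n := by simp [hfill.size]
        rw [Expr.Holds, Expr.eval_cell h0 (by simp [Expr.eval]) (by simp [Expr.eval])]
        simp only [Expr.eval, ne_eq, Nat.reduceEqDiff, OfNat.one_ne_ofNat, not_false_eq_true,
          Function.update_of_ne, Function.update_self, h1, h2]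
        rw [hfill.cell (x + 1) hlt u hu w w.2 (by
          have : (x * n + u + 1) * n ≤ ((x + 1) * n + u) * n := Nat.mul_le_mul_right n (by linarith)
          linarith), ← hk']
        exact hf (x + 1) ⟨u, hu⟩ w
      have hs : ∀ w : Fin n, R k ⟨u, hu⟩ w →
          (st.Holds (Function.update s'.reg 5 w) s'.arr ↔ T ⟨u, hu⟩ w ⟨v, hv⟩) := fun w hw =>
        hstep _ _ ⟨u, hu⟩ w ⟨v, hv⟩ k hfill.other (by simp [hfill.size]) (by simp [h2]) (by simp)
          (by simp [h3]) hw
      simp only [hk, hsucc, hu, hv, exists_true_left, not_le.2 hlt, false_and, false_or,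
        not_false_eq_true, true_and]
      constructor
      · rintro ⟨w, hw, hR, hT⟩
        have hR' := (hmem ⟨w, hw⟩).1 hR
        exact ⟨⟨w, hw⟩, hR', (hs ⟨w, hw⟩ hR').1 hT⟩
      · rintro ⟨w, hR, hT⟩
        exact ⟨w, w.2, (hmem w).2 hR, (hs w hR).2 hT⟩
    · have hk : n - 1 - x = 0 := by omega
      simp [hk, hzero, hge, hu, hv]
  · rw [h.cell x hx u u.2 v v.2 (Nat.zero_le _)]
    exact hf x u v

/-! ### Correctness of the tables and of the result -/

section Tables

variable {G : SimpleGraph (Fin n)}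

/-- There is a walk from `u` to `v` with at most `k` steps. -/
def Within (G : SimpleGraph (Fin n)) (k : ℕ) (u v : Fin n) : Prop :=
  ∃ p : G.Walk u v, p.length ≤ k

theorem within_zero (u v : Fin n) : Within G 0 u v ↔ u = v := by
  constructor
  · rintro ⟨p, hp⟩
    exact SimpleGraph.Walk.eq_of_length_eq_zero (Nat.le_zero.1 hp)
  · rintro rfl
    exact ⟨.nil, le_rfl⟩

theorem within_succ (k : ℕ) (u v : Fin n) :
    Within G (k + 1) u v ↔ ∃ w, Within G k u w ∧ (w = v ∨ G.Adj w v) := by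
  constructor
  · rintro ⟨p, hp⟩
    cases hq : p.reverse with
    | nil => exact ⟨u, ⟨.nil, Nat.zero_le _⟩, .inl rfl⟩
    | @cons _ w _ ha q =>
      refine ⟨w, ⟨q.reverse, ?_⟩, .inr ha.symm⟩
      have := congrArg SimpleGraph.Walk.length hq
      simp only [SimpleGraph.Walk.length_reverse, SimpleGraph.Walk.length_cons] at this ⊢
      omega
  · rintro ⟨w, ⟨p, hp⟩, rfl | ha⟩
    · exact ⟨p, by omega⟩
    · exact ⟨p.concat ha, by simpa using hp⟩

theorem within_iff {k : ℕ} {u v : Fin n} (h : G.Reachable u v) :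
    Within G k u v ↔ G.dist u v ≤ k := by
  constructor
  · rintro ⟨p, hp⟩
    exact (SimpleGraph.dist_le p).trans hp
  · intro hk
    obtain ⟨p, hp⟩ := h.exists_walk_length_eq_dist
    exact ⟨p, hp.trans_le hk⟩

/-- A shortest path repeats no vertex. Hence the `n` layers of table 1 capture all distances. -/
theorem dist_lt {u v : Fin n} (h : G.Reachable u v) : G.dist u v < n := by
  obtain ⟨p, hp, hl⟩ := h.exists_path_of_dist
  simpa [hl] using hp.length_lt

theorem Chain.reachable {k : ℕ} {s b : Fin n} (h : Chain G k s b) : G.Reachable s b := by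
  cases k with
  | zero => obtain rfl : s = b := h; exact .rfl
  | succ k => obtain ⟨c, -, hc⟩ := h; exact hc.1

variable {ρ : ℕ → ℕ} {A : ℕ → ℕ → ℕ}

theorem holds_cell {R : ℕ → Fin n → Fin n → Prop} {m i p q : ℕ} (hA : IsTable m R A)
    (h0 : ρ 0 = n) {x : ℕ} (hx : x < n) {u v : Fin n} (hi : ρ i = x) (hp : ρ p = u) (hq : ρ q = v)
    (hi4 : i ≠ 4) (hp4 : p ≠ 4) :
    (Expr.cell m (.var i) (.var p) (.var q)).Holds ρ A ↔ R (n - 1 - x) u v := by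
  rw [Expr.Holds, Expr.eval_cell h0 (by simp [Expr.eval, hi4]) (by simp [Expr.eval, hp4])]
  simp only [Expr.eval, hi, hp, hq]
  exact hA x hx u v

theorem holds_reach (hA : IsTable 1 (Within G) A) (h0 : ρ 0 = n) {p q : ℕ} {u v : Fin n}
    (hp : ρ p = u) (hq : ρ q = v) (hp4 : p ≠ 4) (hp6 : p ≠ 6) (hq6 : q ≠ 6) :
    (Expr.reach p q).Holds ρ A ↔ G.Reachable u v := by
  have hcell : ∀ k < n, (Expr.cell 1 (.var 6) (.var p) (.var q)).Holds (Function.update ρ 6 k) A ↔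
      Within G (n - 1 - k) u v := fun k hk =>
    holds_cell hA (by simp [h0]) hk (by simp) (by simp [hp6, hp]) (by simp [hq6, hq])
      (by omega) hp4
  rw [Expr.reach, Expr.holds_ex, h0]
  constructor
  · rintro ⟨k, hk, h⟩
    obtain ⟨w, -⟩ := (hcell k hk).1 h
    exact w.reachable
  · intro h
    have := dist_lt h
    exact ⟨0, by omega, (hcell 0 (by omega)).2 ((within_iff h).2 (by omega))⟩

/-- The distance is the number of `k < n` for which `k` edges do not suffice. For unreachable pairs
this count is `n`, while `G.dist` is 0; hence the hypothesis `h`. -/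
theorem eval_dist (hA : IsTable 1 (Within G) A) (h0 : ρ 0 = n) {p q : ℕ} {u v : Fin n}
    (hp : ρ p = u) (hq : ρ q = v) (hp4 : p ≠ 4) (hp6 : p ≠ 6) (hq6 : q ≠ 6)
    (h : G.Reachable u v) : (Expr.dist p q).eval ρ A = G.dist u v := by
  have hcell : ∀ k < n, (Expr.cell 1 (.var 6) (.var p) (.var q)).Holds (Function.update ρ 6 k) A ↔
      G.dist u v ≤ n - 1 - k := fun k hk =>
    (holds_cell hA (by simp [h0]) hk (by simp) (by simp [hp6, hp]) (by simp [hq6, hq])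
      (by omega) hp4).trans (within_iff h)
  classical
  rw [Expr.dist, Expr.eval, h0, Finset.sum_congr rfl
    (g := fun k => if G.dist u v ≤ n - 1 - k then 0 else 1),
    Finset.sum_range_reflect (fun k => if G.dist u v ≤ k then 0 else 1)]
  · have := dist_lt h
    rw [Finset.sum_ite, Finset.sum_const_zero, zero_add, ← Finset.card_eq_sum_ones]
    conv_rhs => rw [← Finset.card_range (G.dist u v)]
    congr 1
    ext k
    simp only [Finset.mem_filter, Finset.mem_range]
    omega
  · intro k hk
    rw [Expr.eval_not]
    exact if_congr (hcell k (Finset.mem_range.1 hk)) rfl rfl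

theorem holds_adjStep (hA : ∀ w v : Fin n, A 0 (w * n + v) ≠ 0 ↔ G.Adj w v) (h0 : ρ 0 = n)
    {w v : Fin n} (h5 : ρ 5 = w) (h3 : ρ 3 = v) :
    Expr.adjStep.Holds ρ A ↔ w = v ∨ G.Adj w v := by
  rw [Expr.adjStep, Expr.holds_or, Expr.holds_eq]
  refine or_congr (by simp [Expr.eval, h5, h3, Fin.ext_iff]) ?_
  rw [Expr.Holds, Expr.eval, Expr.eval_idx₂ h0 (by simp [Expr.eval])]
  simp only [Expr.eval, h5, h3]
  exact hA w v

/-- Together with `hsc`, the reachability test puts all three vertices into one component, where the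
computed distances are correct. -/
theorem holds_farStep (hA : IsTable 1 (Within G) A) (h0 : ρ 0 = n) {s c b : Fin n}
    (h2 : ρ 2 = s) (h5 : ρ 5 = c) (h3 : ρ 3 = b) (hsc : G.Reachable s c) :
    Expr.farStep.Holds ρ A ↔ Step G s c b := by
  rw [Expr.farStep, Step, Expr.holds_and, Expr.holds_and, Expr.holds_le, Expr.holds_le,
    holds_reach hA h0 h2 h3 (by omega) (by omega) (by omega)]
  refine and_congr_right fun hsb => ?_
  simp only [Expr.eval, eval_dist hA h0 h2 h3 (by omega) (by omega) (by omega) hsb,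
    eval_dist hA h0 h2 h5 (by omega) (by omega) (by omega) hsc,
    eval_dist hA h0 h5 h3 (by omega) (by omega) (by omega) (hsc.symm.trans hsb)]
  rfl

theorem ite_one_zero_congr {p q : Prop} {_ : Decidable p} {_ : Decidable q} (h : p ↔ q) :
    (if p then 1 else 0) = if q then 1 else 0 := if_congr h rfl rfl

theorem eval_result {r : Fin n → Fin n → Prop} (hr : IsIncompGraph G r)
    (hA : IsTable 1 (Within G) A) (hA' : IsTable 2 (Chain G) A) (h0 : ρ 0 = n) :
    Expr.result.eval ρ A = indepDomNumber G := by
  classical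
  rw [hr.indepDomNumber_eq, Expr.result, Expr.eval, h0, Finset.sum_range, Fintype.card_fin]
  refine Finset.sum_congr rfl fun v _ => ?_
  -- Chains of `k` steps are stored in layer `n - 1 - k`, so the sum over layers is reversed.
  rw [Expr.eval, ← Finset.sum_range_reflect, Function.update_of_ne (by omega), h0]
  refine Finset.sum_congr rfl fun k hk => ?_
  rw [Finset.mem_range] at hk
  rw [Expr.eval_and]
  refine ite_one_zero_congr ?_
  rw [Expr.holds_and, Expr.holds_not, Expr.holds_ex, Expr.holds_ex]
  have hreach : ∀ (ρ' : ℕ → ℕ) (s : Fin n), ρ' 0 = n → ρ' 1 = v → ρ' 3 = s →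
      ((Expr.reach 1 3).Holds ρ' A ↔ G.Reachable v s) := fun ρ' s h h1 h3 =>
    holds_reach hA h h1 h3 (by omega) (by omega) (by omega)
  refine and_congr ?_ ?_
  · simp only [Expr.holds_and, Expr.holds_not, Expr.holds_le, Expr.eval, not_exists, not_and]
    simp only [ne_eq, OfNat.one_ne_ofNat, not_false_eq_true, Function.update_of_ne,
      Function.update_self, OfNat.zero_ne_ofNat, zero_ne_one, h0, not_le]
    constructor
    · intro h q hq hvq
      exact h q q.2 hq ((hreach _ q (by simp [h0]) (by simp) (by simp)).2 hvq)
    · intro h q hq hqv hvq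
      exact h ⟨q, hq⟩ hqv ((hreach _ ⟨q, hq⟩ (by simp [h0]) (by simp) (by simp)).1 hvq)
  · have hchain : ∀ s b : Fin n, (Expr.cell 2 (.var 2) (.var 3) (.var 5)).Holds
        (Function.update (Function.update (Function.update (Function.update ρ 1 v) 2 (n - 1 - k)) 3 s)
          5 b) A ↔ Chain G k s b := fun s b => by
      have hk' : n - 1 - (n - 1 - k) = k := by omega
      conv_rhs => rw [← hk']
      exact holds_cell hA' (by simp [h0]) (x := n - 1 - k) (by omega) (by simp) (by simp) (by simp) (by omega) (by omega)
    simp only [Expr.holds_ex, Expr.holds_and]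
    simp only [ne_eq, not_false_eq_true, Function.update_of_ne,
      OfNat.zero_ne_ofNat, zero_ne_one, h0]
    constructor
    · rintro ⟨s, hs, b, hb, h1, h2⟩
      exact ⟨⟨s, hs⟩, ⟨b, hb⟩, (hreach _ ⟨s, hs⟩ (by simp [h0]) (by simp) (by simp)).1 h1,
        (hchain ⟨s, hs⟩ ⟨b, hb⟩).1 h2⟩
    · rintro ⟨s, b, h1, h2⟩
      exact ⟨s, s.2, b, b.2, (hreach _ s (by simp [h0]) (by simp) (by simp)).2 h1,
        (hchain s b).2 h2⟩

theorem inputState_adj (w v : Fin n) :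
    (inputState G).arr 0 (w * n + v) ≠ 0 ↔ G.Adj w v := by
  simp only [inputState, true_and, ne_eq, ite_eq_right_iff, one_ne_zero, imp_false, not_not]
  constructor
  · rintro ⟨i, j, hij, he⟩
    obtain ⟨-, h1, h2⟩ := index_injective (x := 0) (x' := 0) w.2 v.2 i.2 j.2 (by simpa using he)
    rwa [Fin.ext h1, Fin.ext h2]
  · exact fun h => ⟨w, v, h, rfl⟩

end Tables

/-! ### The program -/

/-- The program for the independence-domination number of a permutation graph. -/
def indepDomProg : Prog :=
  -- The expressions name only registers 0 to 6, so scratch space begins at 7.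
  .seq (.fill 7 1 (.entry 1 .adjStep)) (.seq (.fill 7 2 (.entry 2 .farStep))
    (.seq (Expr.result.compile 7) (.copy 0 7)))

/-- A bound for the running time of `indepDomProg`. -/
noncomputable def indepDomCost : Polynomial ℕ :=
  fillCost (.entry 1 .adjStep) + (fillCost (.entry 2 .farStep) + (Expr.result.cost + 2))

theorem runs_indepDomProg {G : SimpleGraph (Fin n)} {r : Fin n → Fin n → Prop}
    (hr : IsIncompGraph G r) :
    Runs indepDomProg (inputState G) (indepDomCost.eval n)
      (fun s => s.reg 0 = indepDomNumber G) := by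
  simp only [indepDomCost, Polynomial.eval_add, Polynomial.eval_ofNat]
  have hn : (inputState G).reg 0 = n := by simp [inputState]
  refine .seq (runs_entry (by omega) ?_ hn (within_zero (G := G)) within_succ ?_) ?_
  · simp [Expr.adjStep, Expr.or, Expr.eq, Expr.le, Expr.and, Expr.not, Expr.idx₂, Expr.WF]
  · intro ρ A u w v k hA h0 _ h5 h3 _
    exact holds_adjStep (by rw [hA 0 (by omega)]; exact inputState_adj) h0 h5 h3
  rintro s₁ ⟨h0₁, -, hT₁⟩
  refine .seq (runs_entry (by omega) ?_ h0₁ (R := Chain G) (T := Step G)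
    (fun _ _ => Iff.rfl) (fun _ _ _ => Iff.rfl) ?_) ?_
  · simp [Expr.farStep, Expr.reach, Expr.dist, Expr.cell, Expr.ex, Expr.le, Expr.and, Expr.not,
      Expr.idx₃, Expr.idx₂, Expr.WF]
  · intro ρ A u w v k hA h0 h2 h5 h3 hk
    refine holds_farStep (fun x hx u v => ?_) h0 h2 h5 h3 hk.reachable
    rw [hA 1 (by omega)]
    exact hT₁ x hx u v
  rintro s₂ ⟨h0₂, hA₂, hT₂⟩
  have hT₁' : IsTable 1 (Within G) s₂.arr := fun x hx u v => by
    rw [hA₂ 1 (by omega)]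
    exact hT₁ x hx u v
  refine .seq (by simpa only [h0₂] using Expr.runs_compile (K := 7) (by omega) Expr.result 7 s₂ (by
    simp [Expr.result, Expr.reach, Expr.cell, Expr.ex, Expr.le, Expr.and, Expr.not,
      Expr.idx₃, Expr.idx₂, Expr.WF]) le_rfl) ?_
  rintro s₃ ⟨-, -, hv⟩
  refine .copy (by omega) fun s' _ hs' => ?_
  rw [hs', Function.update_self, hv, eval_result hr hT₁' hT₂ h0₂]

end IndepDom

theorem mainTheorem5 :
    ∃ (P : IndepDom.Prog) (p : Polynomial ℕ),
      IndepDom.ComputesWithin P (fun _ G => IndepDom.IsPermutationGraph G)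
        (fun _ G => IndepDom.indepDomNumber G) (fun n => p.eval n) := by
  refine ⟨IndepDom.indepDomProg, IndepDom.indepDomCost, fun n G hG => ?_⟩
  obtain ⟨r, hr⟩ := hG.exists_isIncompGraph
  exact IndepDom.runs_indepDomProg hr
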